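/- Let $x=(1,0)$, $y=(0,1)$. For coprime non-negative integers $p,q$, the Christoffel word of slope $\frac pq$ is the word $w\in\{x,y\}^*$ encoding the lattice path from $(0,0)$ to $(q,p)$ with steps $x,y$ that lies (weakly) below the segment $L$ from $(0,0)$ to $(q,p)$ and is such that no lattice point lies in the interior of the region between the path and $L$. The word $w$ is non-trivial if $w\ne x$ and $w\ne y$. For a word $w\in\{x,y\}^*$, the folded path $F(w)$ is obtained from the lattice path of $w$ starting at the origin by replacing each $x$-step that starts at odd height (initial point $(a,b)$ with $b$ odd) by the step $-x$. Let $$\Delta_w(t)=\sum_{k\in\mathbb Z}c_kt^k,\qquad G_w(t)=\sum_{k\in\mathbb Z}d_kt^k,$$ where $c_k$ is the number of terminal points of $\pm x$-steps of $F(w)$ with horizontal coordinate $k$, and $d_k$ is the number of points with horizontal coordinate $k$ among the points $s(i,j)$, where $(i,j)$ runs over the terminal points of the $y$-steps of $F(w)$ that are immediately followed by another $y$-step, and $s(i,j)=(i-1,j)$ if $j$ is odd, $s(i,j)=(i,j)$ if $j$ is even. A sequence $(a_i)_{i\in\mathbb Z}$ of non-negative numbers is log-concave if $a_{i-1}a_{i+1}\le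 a_i^2$ for all $i$. For Laurent polynomials $f=\sum a_it^i$ and $g=\sum b_it^i$ write $f\lesssim g$ if $(a_i)$ and $(b_i)$ are non-negative and log-concave and, for all $i$, $a_{i-1}b_{i+1}\le a_ib_i$, $a_{i+1}b_{i-1}\le a_ib_i$ and $a_{i+1}b_i\le a_ib_{i+1}$. **Theorem.** For every non-trivial Christoffel word $w$, the coefficient sequence of $\Delta_w(t)$ is log-concave; moreover, $\Delta_w(t)\lesssim t\,G_w(t)$. -/

import Mathlib

namespace ChristoffelDelta

/-- The two letters of the alphabet; a word is a `List Letter`. -/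
inductive Letter
  | x
  | y
  deriving DecidableEq

/-- The steps `x = (1,0)`, `-x = (-1,0)` and `y = (0,1)`. -/
inductive Step
  | posX
  | negX
  | posY
  deriving DecidableEq

/-- The displacement of a step. -/
def Step.vec : Step → ℤ × ℤ
  | .posX => (1, 0)
  | .negX => (-1, 0)
  | .posY => (0, 1)

/-- A lattice path in `ℤ²` with steps in `{x, -x, y}`. -/
structure LatticePath where
  start : ℤ × ℤ
  steps : List Step

/-! ### Christoffel words -/

/-- The step of the unfolded path given by a letter. -/
def Letter.toStep : Letter → Step
  | .x => .posX
  | .y => .posY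

/-- The path `p_v` of a word `v`, starting at the origin. -/
def wordPath (v : List Letter) : LatticePath :=
  ⟨(0, 0), v.map Letter.toStep⟩

/-- The end point of a path. -/
def LatticePath.terminal (P : LatticePath) : ℤ × ℤ :=
  P.start + (P.steps.map Step.vec).sum

/-- `P.Visits a` : the lattice point `a` lies on the path, i.e. it is the end point of an
initial part of the path. -/
def LatticePath.Visits (P : LatticePath) (a : ℤ × ℤ) : Prop :=
  ∃ s : List Step, s <+: P.steps ∧ a = P.start + (s.map Step.vec).sum

/-- `w` encodes the Christoffel path of slope `p / q`: the path goes from `(0,0)` to `(q,p)`, it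
lies (weakly) below the segment `L` from `(0,0)` to `(q,p)`, and no lattice point `(i,j)` lies in
the interior of the region between the path and `L`, i.e. strictly below `L` and strictly above
the path. (The lattice points of the path on a vertical line form an interval, so `(i,j)` is
strictly above the path exactly if it lies above some point of the path without being a point of
the path.) -/
def IsChristoffelOfSlope (p q : ℕ) (w : List Letter) : Prop :=
  (wordPath w).terminal = ((q : ℤ), (p : ℤ)) ∧
  (∀ i j : ℤ, (wordPath w).Visits (i, j) → j * q ≤ i * p) ∧
  ¬ ∃ i j : ℤ, j * q < i * p ∧
      (∃ h : ℤ, h < j ∧ (wordPath w).Visits (i, h)) ∧ ¬ (wordPath w).Visits (i, j)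

/-- A Christoffel word: the word of the Christoffel path of slope `p / q` for some coprime
non-negative integers `p` and `q`. -/
def IsChristoffelWord (w : List Letter) : Prop :=
  ∃ p q : ℕ, p.Coprime q ∧ IsChristoffelOfSlope p q w

/-- A Christoffel word other than the trivial ones `x` and `y`. -/
def IsNontrivialChristoffelWord (w : List Letter) : Prop :=
  IsChristoffelWord w ∧ w ≠ [.x] ∧ w ≠ [.y]

/-! ### Folded paths -/

/-- Replace every `x`-step that starts at odd height by `-x`; the first argument is the height at
which the remaining part of the path starts. -/
def foldSteps : ℤ → List Letter → List Step
  | _, [] => []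
  | h, .x :: v => (if Odd h then .negX else .posX) :: foldSteps h v
  | h, .y :: v => .posY :: foldSteps (h + 1) v

/-- The folded path `F(v)`. -/
def foldedPath (v : List Letter) : LatticePath :=
  ⟨(0, 0), foldSteps 0 v⟩

/-- The terminal points of the `±x`-steps, for the path with given start and steps. -/
def xDotsAux : ℤ × ℤ → List Step → List (ℤ × ℤ)
  | _, [] => []
  | a, .posY :: l => xDotsAux (a + Step.posY.vec) l
  | a, s :: l => (a + s.vec) :: xDotsAux (a + s.vec) l

/-- The terminal points of the `±x`-steps of a path. -/
def LatticePath.xDots (P : LatticePath) : List (ℤ × ℤ) :=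
  xDotsAux P.start P.steps

/-- The shift `s(i,j) = (i-1,j)` for odd `j`, `s(i,j) = (i,j)` for even `j`. -/
def shiftPoint (a : ℤ × ℤ) : ℤ × ℤ :=
  if Odd a.2 then (a.1 - 1, a.2) else a

/-- The shifted terminal points of the `y`-steps that are immediately followed by a `y`-step, for
the path with given start and steps. -/
def yyDotsAux : ℤ × ℤ → List Step → List (ℤ × ℤ)
  | _, [] => []
  | a, .posY :: .posY :: l =>
      shiftPoint (a + Step.posY.vec) :: yyDotsAux (a + Step.posY.vec) (.posY :: l)
  | a, s :: l => yyDotsAux (a + s.vec) l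

/-- The shifted center points of the `yy`-steps of a path. -/
def LatticePath.yyDots (P : LatticePath) : List (ℤ × ℤ) :=
  yyDotsAux P.start P.steps

/-- The Laurent polynomial whose coefficient at `t ^ k` is the number of listed points with
horizontal coordinate `k`. -/
noncomputable def dotPolynomial (l : List (ℤ × ℤ)) : LaurentPolynomial ℤ :=
  (l.map fun d => LaurentPolynomial.T d.1).sum

/-- `Δ_P(t)`. -/
noncomputable def LatticePath.delta (P : LatticePath) : LaurentPolynomial ℤ :=
  dotPolynomial P.xDots

/-- `G_P(t)`. -/
noncomputable def LatticePath.G (P : LatticePath) : LaurentPolynomial ℤ :=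
  dotPolynomial P.yyDots

/-- `Δ_w(t) = Δ_{F(w)}(t)`. -/
noncomputable def wordDelta (w : List Letter) : LaurentPolynomial ℤ :=
  (foldedPath w).delta

/-- `G_w(t) = G_{F(w)}(t)`. -/
noncomputable def wordG (w : List Letter) : LaurentPolynomial ℤ :=
  (foldedPath w).G

/-! ### Log-concavity and ratio-dominance

Sequences are indexed by `ℤ`, so that the coefficients of two Laurent polynomials are compared
degree by degree. -/

/-- A non-negative log-concave sequence. -/
def IsLogConcave (a : ℤ → ℤ) : Prop :=
  (∀ i, 0 ≤ a i) ∧ ∀ i, a (i - 1) * a (i + 1) ≤ a i ^ 2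

/-- Two non-negative log-concave sequences are synchronized. -/
def Synchronized (a b : ℤ → ℤ) : Prop :=
  IsLogConcave a ∧ IsLogConcave b ∧
  (∀ i, a (i - 1) * b (i + 1) ≤ a i * b i) ∧ ∀ i, a (i + 1) * b (i - 1) ≤ a i * b i

/-- `a ≲ b`: the sequences are synchronized and `b` is ratio-dominant over `a`. -/
def RatioDominated (a b : ℤ → ℤ) : Prop :=
  Synchronized a b ∧ ∀ i, a (i + 1) * b i ≤ a i * b (i + 1)

end ChristoffelDelta

/-! A non-trivial Christoffel word is a product uv for a pair (u, v) obtained from (x, y) by the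
moves (u, v) ↦ (u, uv) and (u, v) ↦ (uv, v). Folding gives each word a value; an odd letter reflects
whatever follows it, so the value of uv is the value of u plus a translated, possibly reflected,
value of v. Reflection symmetry of odd words, carried along the induction, trades reflections for
powers of t.

Log-concavity does not survive sums, so the induction proves more: for every chain c (`IsChain`),
combinations such as c 0 • val u + c 1 • val v have the desired property. A combination for a child
pair is one for its parent with coefficients replaced by segment sums of c, and these again come
from a chain by Cauchy–Binet (`IsChain.segSum`). Everything reduces to the root pair, where the
combinations are themselves chain terms.

For Δ alone the root has x even and y odd (`evenOdd_deltaData`). For the comparison with tG, either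
no yy occurs and G = 0, or the word is an image under x ↦ xy, y ↦ y. Then both root letters are odd
and the root yields two consecutive chain terms (`oddOdd_pairData`), which are ratio-dominated. -/

namespace ChristoffelDelta

open LaurentPolynomial

/-! ### Chains and total positivity of order two. -/

/-- A sequence of Laurent polynomials with non-negative coefficients, shifted by `T 1` every two
steps, whose coefficient matrix is totally positive of order two. -/
structure IsChain (c : ℤ → ℤ[T;T⁻¹]) : Prop where
  nonneg : ∀ i n, 0 ≤ (c i).coeff n
  shift : ∀ i, c (i + 2) = T 1 * c i
  minor : ∀ {i j n m : ℤ}, i ≤ j → n ≤ m →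
    (c i).coeff m * (c j).coeff n ≤ (c i).coeff n * (c j).coeff m

/-- The sum of the terms of `c` with index between `a` and `b`. -/
noncomputable def segSum (c : ℤ → ℤ[T;T⁻¹]) (a b : ℤ) : ℤ[T;T⁻¹] :=
  ∑ l ∈ Finset.Icc a b, c l

theorem coeff_T_mul (k n : ℤ) (f : ℤ[T;T⁻¹]) : (T k * f).coeff n = f.coeff (n - k) := by
  rw [T, AddMonoidAlgebra.coeff_single_mul_apply, one_mul, neg_add_eq_sub]

/-- The Cauchy–Binet inequality for sums over two intervals with ordered end points. -/
theorem sum_Icc_minor_le {c : ℤ → ℤ → ℤ} {a b a' b' n m : ℤ} (ha : a ≤ a') (hb : b ≤ b')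
    (h : ∀ i j, i ≤ j → c i m * c j n ≤ c i n * c j m) :
    (∑ i ∈ Finset.Icc a b, c i m) * (∑ j ∈ Finset.Icc a' b', c j n) ≤
      (∑ i ∈ Finset.Icc a b, c i n) * (∑ j ∈ Finset.Icc a' b', c j m) := by
  classical
  set K := Finset.Icc a b ∪ Finset.Icc a' b' with hK
  have hI : ∀ f : ℤ → ℤ, ∑ i ∈ Finset.Icc a b, f i =
      ∑ i ∈ K, if i ∈ Finset.Icc a b then f i else 0 := by
    intro f
    rw [Finset.sum_ite_mem, hK, Finset.union_inter_cancel_left]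
  have hJ : ∀ f : ℤ → ℤ, ∑ i ∈ Finset.Icc a' b', f i =
      ∑ i ∈ K, if i ∈ Finset.Icc a' b' then f i else 0 := by
    intro f
    rw [Finset.sum_ite_mem, hK, Finset.union_inter_cancel_right]
  set F : ℤ → ℤ → ℤ := fun i j =>
    if i ∈ Finset.Icc a b ∧ j ∈ Finset.Icc a' b' then c i n * c j m - c i m * c j n else 0 with hF
  have key : (∑ i ∈ Finset.Icc a b, c i n) * (∑ j ∈ Finset.Icc a' b', c j m) -
      (∑ i ∈ Finset.Icc a b, c i m) * (∑ j ∈ Finset.Icc a' b', c j n) =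
      ∑ i ∈ K, ∑ j ∈ K, F i j := by
    rw [hI, hJ, hI, hJ, Finset.sum_mul_sum, Finset.sum_mul_sum, ← Finset.sum_sub_distrib]
    refine Finset.sum_congr rfl fun i _ => ?_
    rw [← Finset.sum_sub_distrib]
    refine Finset.sum_congr rfl fun j _ => ?_
    simp only [hF]
    split_ifs <;> simp_all
  -- If i > j and (i, j) is counted, the ordered end points force (j, i) to be counted too, and the
  -- two terms cancel.
  have hsym : ∀ i j, 0 ≤ F i j + F j i := by
    intro i j
    simp only [hF, Finset.mem_Icc]
    rcases le_total i j with hij | hij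
    · have := h i j hij
      split_ifs <;> first | omega | nlinarith
    · have := h j i hij
      split_ifs <;> first | omega | nlinarith
  have h2 : 0 ≤ ∑ i ∈ K, ∑ j ∈ K, (F i j + F j i) :=
    Finset.sum_nonneg fun i _ => Finset.sum_nonneg fun j _ => hsym i j
  have h3 : ∑ i ∈ K, ∑ j ∈ K, (F i j + F j i) = 2 * ∑ i ∈ K, ∑ j ∈ K, F i j := by
    simp only [Finset.sum_add_distrib]
    rw [Finset.sum_comm (f := fun i j => F j i)]
    ring
  linarith

theorem coeff_segSum (c : ℤ → ℤ[T;T⁻¹]) (a b n : ℤ) :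
    (segSum c a b).coeff n = ∑ l ∈ Finset.Icc a b, (c l).coeff n := by
  simp [segSum, AddMonoidAlgebra.coeff_sum, Finsupp.finsetSum_apply]

theorem segSum_self (c : ℤ → ℤ[T;T⁻¹]) (a : ℤ) : segSum c a a = c a := by
  simp [segSum]

theorem segSum_succ (c : ℤ → ℤ[T;T⁻¹]) {a b : ℤ} (h : a ≤ b + 1) :
    segSum c a (b + 1) = segSum c a b + c (b + 1) := by
  have : Finset.Icc a (b + 1) = insert (b + 1) (Finset.Icc a b) := by
    ext i; simp only [Finset.mem_Icc, Finset.mem_insert]; omega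
  rw [segSum, this, Finset.sum_insert (by simp), add_comm, segSum]

theorem segSum_append (c : ℤ → ℤ[T;T⁻¹]) {a b b' d : ℤ} (hb : b' = b + 1) (h : a ≤ b')
    (h' : b ≤ d) : segSum c a d = segSum c a b + segSum c b' d := by
  subst hb
  have : Finset.Icc a d = Finset.Icc a b ∪ Finset.Icc (b + 1) d := by
    ext i; simp only [Finset.mem_Icc, Finset.mem_union]; omega
  rw [segSum, this, Finset.sum_union, segSum, segSum]
  exact Finset.disjoint_left.2 fun i hi hi' => by
    simp only [Finset.mem_Icc] at hi hi'; omega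

namespace IsChain

variable {c : ℤ → ℤ[T;T⁻¹]}

theorem shift_segSum (hc : IsChain c) (a b : ℤ) :
    T 1 * segSum c a b = segSum c (a + 2) (b + 2) := by
  rw [segSum, segSum, Finset.mul_sum, ← Finset.map_add_right_Icc, Finset.sum_map]
  simp [hc.shift]

theorem comp_add (hc : IsChain c) (k : ℤ) : IsChain fun i => c (i + k) where
  nonneg i n := hc.nonneg _ n
  shift i := by rw [show i + 2 + k = i + k + 2 by ring, hc.shift]
  minor h h' := hc.minor (by omega) h'

/-- Cauchy–Binet gives the minors because both end points are monotone; their compatibility with i ↦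
i + 2 gives the shift rule. -/
theorem segSum (hc : IsChain c) {lo hi : ℤ → ℤ} (hlo : Monotone lo) (hhi : Monotone hi)
    (hlo' : ∀ i, lo (i + 2) = lo i + 2) (hhi' : ∀ i, hi (i + 2) = hi i + 2) :
    IsChain fun i => segSum c (lo i) (hi i) where
  nonneg i n := by
    rw [coeff_segSum]
    exact Finset.sum_nonneg fun l _ => hc.nonneg l n
  shift i := by rw [hlo', hhi', hc.shift_segSum]
  minor h h' := by
    simp only [coeff_segSum]
    exact sum_Icc_minor_le (c := fun i n => (c i).coeff n) (hlo h) (hhi h)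
      fun i j hij => hc.minor hij h'

/-- Row i + 2 is row i translated by one, so the minors of these two rows are the log-concavity
inequalities. -/
theorem isLogConcave (hc : IsChain c) (i : ℤ) : IsLogConcave fun k => (c i).coeff k := by
  refine ⟨hc.nonneg i, fun k => ?_⟩
  have := hc.minor (show i ≤ i + 2 by omega) (show k ≤ k + 1 by omega)
  simp only [hc.shift, coeff_T_mul, add_sub_cancel_right] at this
  linarith

/-- The three mixed inequalities are minors of the rows (i + 1, i + 2), (i, i + 3) and (i, i + 1).
-/
theorem ratioDominated (hc : IsChain c) (i : ℤ) :
    RatioDominated (fun k => (c i).coeff k) fun k => (c (i + 1)).coeff k := by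
  refine ⟨⟨hc.isLogConcave i, hc.isLogConcave (i + 1), fun k => ?_, fun k => ?_⟩, fun k => ?_⟩
  · have := hc.minor (show i + 1 ≤ i + 2 by omega) (show k ≤ k + 1 by omega)
    simp only [hc.shift, coeff_T_mul, add_sub_cancel_right] at this
    linarith
  · have := hc.minor (show i ≤ i + 1 + 2 by omega) (show k ≤ k + 1 by omega)
    simp only [hc.shift, coeff_T_mul, add_sub_cancel_right] at this
    linarith
  · have := hc.minor (show i ≤ i + 1 by omega) (show k ≤ k + 1 by omega)
    linarith

end IsChain

/-- The chain `…, 1, 0, t, 0, t², …`. -/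
noncomputable def evenChain (i : ℤ) : ℤ[T;T⁻¹] := if Even i then T (i / 2) else 0

theorem coeff_evenChain (i n : ℤ) : (evenChain i).coeff n = if i = 2 * n then 1 else 0 := by
  rw [evenChain]
  split_ifs with h h' h'
  · rw [T_apply, if_pos (by omega)]
  · rw [Int.even_iff] at h
    rw [T_apply, if_neg (by omega)]
  · exact absurd ⟨n, by omega⟩ h
  · simp

theorem isChain_evenChain : IsChain evenChain where
  nonneg i n := by rw [coeff_evenChain]; split_ifs <;> norm_num
  shift i := by
    ext n
    rw [coeff_T_mul, coeff_evenChain, coeff_evenChain]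
    congr 1
    simp only [eq_iff_iff]; omega
  minor h h' := by
    simp only [coeff_evenChain]
    split_ifs <;> omega

/-! ### Folding words and the three parity invariants. -/

/-- Data for evaluating words by folding: each letter has a parity, a displacement and a value in a
module over the Laurent polynomials, and `J` is the semilinear reflection applied to whatever
follows an odd letter. -/
structure FoldData (M : Type*) [AddCommGroup M] [Module ℤ[T;T⁻¹] M] where
  J : M →+ M
  J_smul : ∀ (k : ℤ) (m : M), J ((T k : ℤ[T;T⁻¹]) • m) = (T (-k) : ℤ[T;T⁻¹]) • J m
  J_J : ∀ m, J (J m) = m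
  odd : Letter → Bool
  disp : Letter → ℤ
  val : Letter → M

namespace FoldData

variable {M : Type*} [AddCommGroup M] [Module ℤ[T;T⁻¹] M] (D : FoldData M)

/-- The parity of a word. -/
def wodd : List Letter → Bool
  | [] => false
  | l :: w => xor (D.odd l) (wodd w)

/-- The displacement of a word. -/
def wdisp : List Letter → ℤ
  | [] => 0
  | l :: w => D.disp l + if D.odd l then -wdisp w else wdisp w

/-- The value of a word. -/
noncomputable def wval : List Letter → M
  | [] => 0
  | l :: w => D.val l + (T (D.disp l) : ℤ[T;T⁻¹]) • if D.odd l then D.J (wval w) else wval w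

theorem wodd_append (u v : List Letter) : D.wodd (u ++ v) = xor (D.wodd u) (D.wodd v) := by
  induction u with
  | nil => simp [wodd]
  | cons l u ih => simp [wodd, ih]

theorem wdisp_append (u v : List Letter) :
    D.wdisp (u ++ v) = D.wdisp u + if D.wodd u then -D.wdisp v else D.wdisp v := by
  induction u with
  | nil => simp [wodd, wdisp]
  | cons l u ih =>
    simp only [List.cons_append, wdisp, wodd, ih]
    by_cases hl : D.odd l = true <;> by_cases hu : D.wodd u = true <;> simp [hl, hu] <;> ring

theorem wval_append (u v : List Letter) :
    D.wval (u ++ v) = D.wval u +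
      (T (D.wdisp u) : ℤ[T;T⁻¹]) • if D.wodd u then D.J (D.wval v) else D.wval v := by
  induction u with
  | nil => simp [wodd, wdisp, wval]
  | cons l u ih =>
    simp only [List.cons_append, wdisp, wodd, wval, ih]
    by_cases hl : D.odd l = true <;> by_cases hu : D.wodd u = true <;>
      simp only [hl, hu, if_true, if_false, map_add, smul_add, smul_smul, ← T_add, D.J_smul, D.J_J,
        add_assoc, Bool.xor_true, Bool.xor_false, Bool.not_true, Bool.not_false, Bool.false_eq_true]

variable (P : M → Prop)

/-- A pair of odd words for which all chain combinations of the values satisfy `P`. -/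
structure OddOdd (u v : List Letter) : Prop where
  odd_left : D.wodd u = true
  odd_right : D.wodd v = true
  disp : D.wdisp u = D.wdisp v + 1
  symm_left : D.J (D.wval u) = (T (-D.wdisp u - 1) : ℤ[T;T⁻¹]) • D.wval u
  symm_right : D.J (D.wval v) = (T (-D.wdisp v - 1) : ℤ[T;T⁻¹]) • D.wval v
  good : ∀ c, IsChain c → P (c 0 • D.wval u + c 1 • D.wval v)

/-- The analogue of `OddOdd` for an even word followed by an odd word. -/
structure EvenOdd (u v : List Letter) : Prop where
  odd_left : D.wodd u = false
  odd_right : D.wodd v = true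
  disp : D.wdisp u = 1
  symm_right : D.J (D.wval v) = (T (-D.wdisp v - 1) : ℤ[T;T⁻¹]) • D.wval v
  -- Given `symm_right`, this is equivalent to the reflection symmetry of the odd word u ++ v.
  symm : (T (D.wdisp v + 2) : ℤ[T;T⁻¹]) • D.J (D.wval u) + D.wval v =
    D.wval u + (T 1 : ℤ[T;T⁻¹]) • D.wval v
  -- The parameter k absorbs repeated moves v ↦ u ++ v, which keep this parity type; k = 0 serves
  -- the move to `OddOdd`.
  good : ∀ c, IsChain c → ∀ k : ℕ,
    P (segSum c 0 (2 * k) • D.wval u + segSum c (2 * k + 1) (2 * k + 2) • D.wval v)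

/-- The analogue of `OddOdd` for an odd word followed by an even word. -/
structure OddEven (u v : List Letter) : Prop where
  odd_left : D.wodd u = true
  odd_right : D.wodd v = false
  disp : D.wdisp v = 1
  symm_left : D.J (D.wval u) = (T (-D.wdisp u - 1) : ℤ[T;T⁻¹]) • D.wval u
  symm : (T (-1) : ℤ[T;T⁻¹]) • D.wval u + D.wval v =
    D.wval u + (T (D.wdisp u) : ℤ[T;T⁻¹]) • D.J (D.wval v)
  -- Here k absorbs repeated moves u ↦ u ++ v.
  good : ∀ c, IsChain c → ∀ k : ℕ,
    P (segSum c 0 1 • D.wval u +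
      segSum c (1 - 2 * k) 1 • (T (D.wdisp u) : ℤ[T;T⁻¹]) • D.J (D.wval v))

variable {D P} {u v : List Letter}

namespace OddOdd

theorem wval_append (h : D.OddOdd P u v) : D.wval (u ++ v) = D.wval u + D.wval v := by
  rw [D.wval_append, if_pos h.odd_left, h.symm_right, smul_smul, ← T_add, h.disp]
  simp

theorem wdisp_append (h : D.OddOdd P u v) : D.wdisp (u ++ v) = 1 := by
  rw [D.wdisp_append, if_pos h.odd_left, h.disp]; ring

theorem J_wval_append (h : D.OddOdd P u v) : D.J (D.wval (u ++ v)) =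
    (T (-D.wdisp u) : ℤ[T;T⁻¹]) • ((T (-1) : ℤ[T;T⁻¹]) • D.wval u + D.wval v) := by
  rw [h.wval_append, map_add, h.symm_left, h.symm_right, smul_add, smul_smul, ← T_add, h.disp]
  congr 3; ring_nf

theorem evenOdd (h : D.OddOdd P u v) : D.EvenOdd P (u ++ v) v where
  odd_left := by simp [D.wodd_append, h.odd_left, h.odd_right]
  odd_right := h.odd_right
  disp := h.wdisp_append
  symm_right := h.symm_right
  symm := by
    rw [h.J_wval_append, h.wval_append, smul_smul, ← T_add, h.disp, smul_add, smul_smul, ← T_add,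
      show D.wdisp v + 2 + -(D.wdisp v + 1) = 1 by ring, show (1 : ℤ) + -1 = 0 by ring, T_zero,
      one_smul]
    abel
  good c hc k := by
    -- At i = 0, 1 the segments are [0, 2k] and [0, 2k + 2], the coefficients of val u and val v
    -- after expanding val (u ++ v).
    have hc' := hc.segSum (lo := fun i => 2 * (i / 2)) (hi := fun i => 2 * ((i + 1) / 2) + 2 * k)
      (fun i j hij => by dsimp only; omega) (fun i j hij => by dsimp only; omega)
      (fun i => by omega) (fun i => by omega)
    have := h.good _ hc'
    norm_num at this
    rw [h.wval_append, smul_add, add_assoc, ← add_smul, ← segSum_append c (by omega) (by omega) (by omega),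
      add_comm (2 * (k : ℤ)) 2]
    exact this

theorem oddEven (h : D.OddOdd P u v) : D.OddEven P u (u ++ v) where
  odd_left := h.odd_left
  odd_right := by simp [D.wodd_append, h.odd_left, h.odd_right]
  disp := h.wdisp_append
  symm_left := h.symm_left
  symm := by
    rw [h.J_wval_append, h.wval_append, smul_smul, ← T_add, add_neg_cancel, T_zero, one_smul]
    abel
  good c hc k := by
    -- At i = 0, 1 the segments are [-1 - 2k, 1] and [1 - 2k, 1].
    have hc' := hc.segSum (lo := fun i => 2 * ((i + 1) / 2) - 1 - 2 * k)
      (hi := fun i => 2 * (i / 2) + 1)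
      (fun i j hij => by dsimp only; omega) (fun i j hij => by dsimp only; omega)
      (fun i => by omega) (fun i => by omega)
    have := h.good _ hc'
    norm_num at this
    have h1 : (T (-1) : ℤ[T;T⁻¹]) * segSum c (1 - 2 * k) 1 = segSum c (-1 - 2 * k) (-1) := by
      have := hc.shift_segSum (-1 - 2 * k) (-1)
      rw [show -1 - 2 * (k : ℤ) + 2 = 1 - 2 * k by ring, show (-1 : ℤ) + 2 = 1 by norm_num] at this
      rw [← this, ← mul_assoc, ← T_add, neg_add_cancel, T_zero, one_mul]
    rw [h.J_wval_append, smul_smul (T _), ← T_add, add_neg_cancel, T_zero, one_smul, smul_add,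
      smul_smul, mul_comm _ (T (-1)), h1, ← add_assoc, ← add_smul, add_comm (segSum c 0 1),
      ← segSum_append c (by omega) (by omega) (by omega)]
    convert this using 4

end OddOdd

namespace EvenOdd

theorem wval_append (h : D.EvenOdd P u v) :
    D.wval (u ++ v) = D.wval u + (T 1 : ℤ[T;T⁻¹]) • D.wval v := by
  rw [D.wval_append, h.odd_left, h.disp]; simp

theorem wdisp_append (h : D.EvenOdd P u v) : D.wdisp (u ++ v) = D.wdisp v + 1 := by
  rw [D.wdisp_append, h.odd_left, h.disp, add_comm]; simp

theorem symm_append (h : D.EvenOdd P u v) : D.J (D.wval (u ++ v)) =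
    (T (-D.wdisp (u ++ v) - 1) : ℤ[T;T⁻¹]) • D.wval (u ++ v) := by
  rw [h.wdisp_append, h.wval_append, map_add, D.J_smul, h.symm_right, ← h.symm, smul_add,
    smul_smul, ← T_add, smul_smul, ← T_add, show -(D.wdisp v + 1) - 1 + (D.wdisp v + 2) = 0 by ring,
    T_zero, one_smul]
  congr 3; ring

theorem oddOdd (h : D.EvenOdd P u v) : D.OddOdd P (u ++ v) v where
  odd_left := by simp [D.wodd_append, h.odd_left, h.odd_right]
  odd_right := h.odd_right
  disp := h.wdisp_append
  symm_left := h.symm_append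
  symm_right := h.symm_right
  good c hc := by
    have := h.good c hc 0
    have h2 : T 1 * c 0 = c 2 := (hc.shift 0).symm
    have h3 : segSum c 1 2 = c 1 + c 2 := by
      rw [show (2 : ℤ) = 1 + 1 by norm_num, segSum_succ c (by omega), segSum_self]
    norm_num [segSum_self, h3] at this
    rw [h.wval_append, smul_add, smul_smul, mul_comm, h2, add_assoc, ← add_smul, add_comm (c 2)]
    exact this

theorem evenOdd (h : D.EvenOdd P u v) : D.EvenOdd P u (u ++ v) where
  odd_left := h.odd_left
  odd_right := by simp [D.wodd_append, h.odd_left, h.odd_right]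
  disp := h.disp
  symm_right := h.symm_append
  symm := by
    have := congrArg (fun m => (T 1 : ℤ[T;T⁻¹]) • m) h.symm
    simp only [smul_add, smul_smul, ← T_add] at this
    rw [h.wdisp_append, h.wval_append, smul_add, smul_smul, ← T_add,
      show D.wdisp v + 1 + 2 = 1 + (D.wdisp v + 2) by ring, add_left_comm, this]
  good c hc k := by
    -- Expanding val (u ++ v) merges the two adjacent segments on val u and moves the one on val v
    -- up by two.
    have := h.good c hc (k + 1)
    have h1 := hc.shift_segSum (2 * k + 1) (2 * k + 2)
    rw [h.wval_append, smul_add, smul_smul, mul_comm _ (T 1), h1, ← add_assoc, ← add_smul,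
      ← segSum_append c (by omega) (by omega) (by omega)]
    push_cast at this
    convert this using 4 <;> ring

end EvenOdd

namespace OddEven

theorem wval_append (h : D.OddEven P u v) :
    D.wval (u ++ v) = D.wval u + (T (D.wdisp u) : ℤ[T;T⁻¹]) • D.J (D.wval v) := by
  rw [D.wval_append, if_pos h.odd_left]

theorem wdisp_append (h : D.OddEven P u v) : D.wdisp (u ++ v) = D.wdisp u - 1 := by
  rw [D.wdisp_append, if_pos h.odd_left, h.disp, sub_eq_add_neg]

theorem symm_append (h : D.OddEven P u v) : D.J (D.wval (u ++ v)) =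
    (T (-D.wdisp (u ++ v) - 1) : ℤ[T;T⁻¹]) • D.wval (u ++ v) := by
  rw [h.wdisp_append, h.wval_append, map_add, D.J_smul, D.J_J, ← h.symm, h.symm_left, smul_add,
    smul_smul, ← T_add]
  congr 3 <;> ring

theorem oddOdd (h : D.OddEven P u v) : D.OddOdd P u (u ++ v) where
  odd_left := h.odd_left
  odd_right := by simp [D.wodd_append, h.odd_left, h.odd_right]
  disp := by rw [h.wdisp_append]; ring
  symm_left := h.symm_left
  symm_right := h.symm_append
  good c hc := by
    have := h.good c hc 0
    have h3 : segSum c 0 1 = c 0 + c 1 := by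
      rw [show (1 : ℤ) = 0 + 1 by norm_num, segSum_succ c (by omega), segSum_self]
    norm_num [segSum_self, h3] at this
    rw [h.wval_append, smul_add, ← add_assoc, ← add_smul]
    exact this

theorem oddEven (h : D.OddEven P u v) : D.OddEven P (u ++ v) v where
  odd_left := by simp [D.wodd_append, h.odd_left, h.odd_right]
  odd_right := h.odd_right
  disp := h.disp
  symm_left := h.symm_append
  symm := by
    have := h.symm
    rw [h.wdisp_append, h.wval_append, smul_add, smul_smul, ← T_add,
      show -1 + D.wdisp u = D.wdisp u - 1 by ring, add_right_comm, this]
  good c hc k := by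
    have := h.good c hc (k + 1)
    have h1 := hc.shift_segSum (-1 - 2 * k) (-1)
    rw [show -1 - 2 * (k : ℤ) + 2 = 1 - 2 * k by ring, show (-1 : ℤ) + 2 = 1 by norm_num] at h1
    have h2 : segSum c (1 - 2 * k) 1 * T (D.wdisp u - 1) =
        segSum c (-1 - 2 * k) (-1) * T (D.wdisp u) := by
      rw [← h1, mul_comm (T 1), mul_assoc, ← T_add, add_sub_cancel]
    rw [h.wval_append, h.wdisp_append, smul_add, smul_smul _ (T (_ - 1)), h2, ← smul_smul, add_assoc,
      ← add_smul, add_comm (segSum c 0 1), ← segSum_append c (by omega) (by omega) (by omega)]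
    push_cast at this
    convert this using 4; ring

end OddEven

end FoldData

/-! ### Induction on the Christoffel tree. -/

/-- The pairs of words on the Christoffel tree. -/
inductive TreePair : List Letter → List Letter → Prop
  | base : TreePair [.x] [.y]
  | right {u v : List Letter} : TreePair u v → TreePair u (u ++ v)
  | left {u v : List Letter} : TreePair u v → TreePair (u ++ v) v

/-- The constant-on-blocks chain `…, 1, 1, t, t, t², …`. -/
noncomputable def doubleChain (i : ℤ) : ℤ[T;T⁻¹] := segSum evenChain (i - 1) i

theorem isChain_doubleChain : IsChain doubleChain :=
  isChain_evenChain.segSum (lo := fun i => i - 1) (hi := fun i => i)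
    (fun i j hij => by dsimp only; omega) (fun i j hij => hij) (fun i => by ring) (fun i => rfl)

theorem doubleChain_zero : doubleChain 0 = 1 := by
  ext n
  rw [doubleChain, show (0 : ℤ) = -1 + 1 by norm_num, segSum_succ _ (by norm_num)]
  norm_num [segSum_self, evenChain]

theorem doubleChain_one : doubleChain 1 = 1 := by
  ext n
  rw [doubleChain, show (1 : ℤ) = 0 + 1 by norm_num, segSum_succ _ (by norm_num)]
  norm_num [segSum_self, evenChain]

namespace FoldData

variable {M : Type*} [AddCommGroup M] [Module ℤ[T;T⁻¹] M] {D : FoldData M} {P : M → Prop}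
  {u v : List Letter}

/-- Special chains recover actual values: (c 0, c 1) is (1, 0) here, then (0, 1) and (1, 1) in the
next two lemmas. -/
theorem OddOdd.good_left (h : D.OddOdd P u v) : P (D.wval u) := by
  have := h.good _ isChain_evenChain
  norm_num [evenChain] at this
  exact this

theorem OddOdd.good_right (h : D.OddOdd P u v) : P (D.wval v) := by
  have := h.good _ (isChain_evenChain.comp_add (-1))
  norm_num [evenChain] at this
  exact this

theorem OddOdd.good_append (h : D.OddOdd P u v) : P (D.wval (u ++ v)) := by
  have := h.good _ isChain_doubleChain
  rw [doubleChain_zero, doubleChain_one, one_smul, one_smul] at this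
  rwa [h.wval_append]

/-- If the root of the Christoffel tree satisfies one of the three invariants, then the values of
all products of tree pairs satisfy `P`. -/
theorem good_of_treePair (h : D.OddOdd P [.x] [.y] ∨ D.EvenOdd P [.x] [.y] ∨ D.OddEven P [.x] [.y])
    (huv : TreePair u v) : P (D.wval (u ++ v)) := by
  -- The moves never produce two even words; each sends one of the three invariants to itself or to
  -- another.
  have : D.OddOdd P u v ∨ D.EvenOdd P u v ∨ D.OddEven P u v := by
    induction huv with
    | base => exact h
    | right _ ih =>
      rcases ih with ih | ih | ih
      · exact .inr (.inr ih.oddEven)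
      · exact .inr (.inl ih.evenOdd)
      · exact .inl ih.oddOdd
    | left _ ih =>
      rcases ih with ih | ih | ih
      · exact .inr (.inl ih.evenOdd)
      · exact .inl ih.oddOdd
      · exact .inr (.inr ih.oddEven)
  rcases this with h | h | h
  · exact h.good_append
  · exact h.oddOdd.good_left
  · exact h.oddOdd.good_right

end FoldData

/-! ### Substitutions generating the tree words. -/

/-- The substitution `x ↦ x`, `y ↦ xy`. -/
def substG : List Letter → List Letter
  | [] => []
  | .x :: w => .x :: substG w
  | .y :: w => .x :: .y :: substG w

/-- The substitution `x ↦ xy`, `y ↦ y`. -/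
def substD : List Letter → List Letter
  | [] => []
  | .x :: w => .x :: .y :: substD w
  | .y :: w => .y :: substD w

theorem substG_append (u v : List Letter) : substG (u ++ v) = substG u ++ substG v := by
  induction u with
  | nil => rfl
  | cons l u ih => cases l <;> simp [substG, ih]

theorem substD_append (u v : List Letter) : substD (u ++ v) = substD u ++ substD v := by
  induction u with
  | nil => rfl
  | cons l u ih => cases l <;> simp [substD, ih]

theorem count_substG (w : List Letter) :
    (substG w).count .x = w.count .x + w.count .y ∧ (substG w).count .y = w.count .y := by
  induction w with
  | nil => simp [substG]
  | cons l u ih => cases l <;> simp [substG, ih] <;> omega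

theorem count_substD (w : List Letter) :
    (substD w).count .x = w.count .x ∧ (substD w).count .y = w.count .x + w.count .y := by
  induction w with
  | nil => simp [substD]
  | cons l u ih => cases l <;> simp [substD, ih] <;> omega

theorem length_eq_count (w : List Letter) : w.length = w.count .x + w.count .y := by
  induction w with
  | nil => rfl
  | cons l u ih => cases l <;> simp [ih] <;> omega

/-- The words obtained from `xy` by the two substitutions. -/
inductive Generated : List Letter → Prop
  | base : Generated [.x, .y]
  | substG {w : List Letter} : Generated w → Generated (substG w)
  | substD {w : List Letter} : Generated w → Generated (substD w)

/-- The root goes to its child (x, xy), and substitution commutes with concatenation, hence with the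
moves. -/
theorem TreePair.substG {u v : List Letter} (h : TreePair u v) :
    TreePair (substG u) (substG v) := by
  induction h with
  | base => exact .right .base
  | right _ ih => rw [substG_append]; exact .right ih
  | left _ ih => rw [substG_append]; exact .left ih

theorem TreePair.substD {u v : List Letter} (h : TreePair u v) :
    TreePair (substD u) (substD v) := by
  induction h with
  | base => exact .left .base
  | right _ ih => rw [substD_append]; exact .right ih
  | left _ ih => rw [substD_append]; exact .left ih

theorem Generated.exists_treePair {w : List Letter} (h : Generated w) :
    ∃ u v, TreePair u v ∧ w = u ++ v := by
  induction h with
  | base => exact ⟨_, _, .base, rfl⟩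
  | substG _ ih =>
    obtain ⟨u, v, h, rfl⟩ := ih
    exact ⟨_, _, h.substG, substG_append u v⟩
  | substD _ ih =>
    obtain ⟨u, v, h, rfl⟩ := ih
    exact ⟨_, _, h.substD, substD_append u v⟩

theorem Generated.exists_eq_cons {w : List Letter} (h : Generated w) : ∃ w', w = .x :: w' := by
  induction h with
  | base => exact ⟨_, rfl⟩
  | substG _ ih => obtain ⟨w', rfl⟩ := ih; exact ⟨_, rfl⟩
  | substD _ ih => obtain ⟨w', rfl⟩ := ih; exact ⟨_, rfl⟩

/-! ### Christoffel words as greedy words -/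

/-- Starting at `i * p - j * q = n`, the word takes a `y`-step exactly if it stays weakly below the
line of slope `p / q`. -/
def Greedy (p q : ℤ) : ℤ → List Letter → Prop
  | _, [] => True
  | n, .x :: w => n < q ∧ Greedy p q (n + p) w
  | n, .y :: w => q ≤ n ∧ Greedy p q (n - q) w

/-- At each level n exactly one letter is allowed. -/
theorem Greedy.eq {p q n : ℤ} {w w' : List Letter} (h : Greedy p q n w) (h' : Greedy p q n w')
    (hl : w.length = w'.length) : w = w' := by
  induction w generalizing n w' with
  | nil => exact (List.length_eq_zero_iff.1 hl.symm).symm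
  | cons l w ih =>
    cases w' with
    | nil => simp at hl
    | cons l' w' =>
      have hl' : w.length = w'.length := by simpa using hl
      cases l <;> cases l' <;> simp only [Greedy] at h h'
      · rw [ih h.2 h'.2 hl']
      · omega
      · omega
      · rw [ih h.2 h'.2 hl']

theorem Greedy.substG {p q n : ℤ} {w : List Letter} (h : Greedy p q n w) (hq : 0 ≤ q)
    (hn : n < p + q) : Greedy p (p + q) n (substG w) := by
  induction w generalizing n with
  | nil => trivial
  | cons l w ih =>
    cases l <;> simp only [Greedy, ChristoffelDelta.substG] at h ⊢
    · exact ⟨hn, ih h.2 (by omega)⟩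
    · refine ⟨hn, by omega, ?_⟩
      rw [show n + p - (p + q) = n - q by ring]
      exact ih h.2 (by omega)

theorem Greedy.substD {p q n : ℤ} {w : List Letter} (h : Greedy p q n w) (hp : 0 ≤ p)
    (hn : 0 ≤ n) : Greedy (p + q) q n (substD w) := by
  induction w generalizing n with
  | nil => trivial
  | cons l w ih =>
    cases l <;> simp only [Greedy, ChristoffelDelta.substD] at h ⊢
    · refine ⟨h.1, by omega, ?_⟩
      rw [show n + (p + q) - q = n + p by ring]
      exact ih h.2 (by omega)
    · exact ⟨h.1, ih h.2 (by omega)⟩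

/-- Subtractive Euclidean algorithm: each subtraction is undone by a substitution, down to p = q =
1. -/
theorem exists_generated_greedy (N p q : ℕ) (hN : p + q ≤ N) (hp : 0 < p) (hq : 0 < q)
    (hpq : p.Coprime q) :
    ∃ w, Generated w ∧ Greedy p q 0 w ∧ w.count .x = q ∧ w.count .y = p := by
  induction N generalizing p q with
  | zero => omega
  | succ N ih =>
    rcases lt_trichotomy p q with h | rfl | h
    · obtain ⟨r, rfl⟩ := Nat.exists_eq_add_of_lt h
      obtain ⟨w, hw, hg, hx, hy⟩ := ih p (r + 1) (by omega) hp (by omega)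
        (by rwa [add_assoc, Nat.coprime_self_add_right] at hpq)
      refine ⟨_, hw.substG, ?_, ?_, ?_⟩
      · have := hg.substG (by omega) (by push_cast; omega)
        push_cast at this ⊢
        rwa [add_assoc]
      · rw [(count_substG w).1]; omega
      · rw [(count_substG w).2]; omega
    · obtain rfl : p = 1 := by simpa using hpq
      exact ⟨_, .base, by simp [Greedy], rfl, rfl⟩
    · obtain ⟨r, rfl⟩ := Nat.exists_eq_add_of_lt h
      obtain ⟨w, hw, hg, hx, hy⟩ := ih (r + 1) q (by omega) (by omega) hq
        (by rwa [add_assoc, Nat.coprime_self_add_left] at hpq)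
      refine ⟨_, hw.substD, ?_, ?_, ?_⟩
      · have := hg.substD (by omega) le_rfl
        push_cast at this ⊢
        rwa [add_assoc, add_comm]
      · rw [(count_substD w).1]; omega
      · rw [(count_substD w).2]; omega

theorem sum_vec_map_toStep (s : List Letter) :
    ((s.map Letter.toStep).map Step.vec).sum = ((s.count .x : ℤ), (s.count .y : ℤ)) := by
  induction s with
  | nil => rfl
  | cons l s ih =>
    rw [List.map_cons, List.map_cons, List.sum_cons, ih]
    cases l <;> simp [Letter.toStep, Step.vec, add_comm]

theorem visits_wordPath {w : List Letter} {i j : ℤ} : (wordPath w).Visits (i, j) ↔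
    ∃ s, s <+: w ∧ i = (s.count .x : ℤ) ∧ j = (s.count .y : ℤ) := by
  constructor
  · rintro ⟨s, hs, h⟩
    obtain ⟨r, hr, rfl⟩ := (List.prefix_map_iff (f := Letter.toStep)).1 hs
    rw [sum_vec_map_toStep] at h
    exact ⟨r, hr, by simpa [wordPath] using h⟩
  · rintro ⟨s, hs, rfl, rfl⟩
    refine ⟨s.map Letter.toStep, hs.map _, ?_⟩
    rw [sum_vec_map_toStep]
    simp [wordPath]

theorem greedy_of_forall_split {p q : ℤ} {w s r : List Letter} (hw : w = s ++ r)
    (h : ∀ s l r, w = s ++ l :: r →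
      (l = .x ↔ (s.count .x : ℤ) * p - (s.count .y : ℤ) * q < q)) :
    Greedy p q ((s.count .x : ℤ) * p - (s.count .y : ℤ) * q) r := by
  induction r generalizing s with
  | nil => trivial
  | cons l r ih =>
    have h1 := h s l r hw
    have h2 := ih (s := s ++ [l]) (by simp [hw])
    cases l
    · refine ⟨h1.1 rfl, ?_⟩
      convert h2 using 1
      simp; ring
    · refine ⟨not_lt.1 fun hlt => by simpa using h1.2 hlt, ?_⟩
      convert h2 using 1
      simp; ring

theorem IsChristoffelOfSlope.count {p q : ℕ} {w : List Letter} (h : IsChristoffelOfSlope p q w) :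
    w.count .x = q ∧ w.count .y = p := by
  have := h.1
  rw [LatticePath.terminal, wordPath, sum_vec_map_toStep] at this
  simpa using this

theorem IsChristoffelOfSlope.greedy {p q : ℕ} {w : List Letter} (hpq : p.Coprime q)
    (h : IsChristoffelOfSlope p q w) : Greedy p q 0 w := by
  have key := greedy_of_forall_split (p := p) (q := q) (w := w) (s := []) (r := w) rfl ?_
  · simpa using key
  intro s l r hw
  obtain ⟨hx, hy⟩ := h.count
  obtain ⟨-, hbelow, hno⟩ := h
  cases l
  · simp only [true_iff]
    -- If an x-step is taken where y was allowed, the point just above is off the path. It is either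
    -- strictly below L, hence forbidden, or on L, which coprimality excludes.
    by_contra! hle
    have hlt : s.count .x < q := by
      rw [← hx, hw]; simp
    have hvis : (wordPath w).Visits ((s.count .x : ℤ), (s.count .y : ℤ)) :=
      visits_wordPath.2 ⟨s, ⟨_, hw.symm⟩, rfl, rfl⟩
    have hnvis : ¬ (wordPath w).Visits ((s.count .x : ℤ), (s.count .y : ℤ) + 1) := by
      rw [visits_wordPath]
      rintro ⟨s', hs', h1, h2⟩
      have hs : s ++ [.x] <+: w := ⟨r, by simp [hw]⟩
      rcases List.prefix_or_prefix_of_prefix hs hs' with hp | hp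
      · have := hp.sublist.count_le .x
        simp at this; omega
      · have := hp.sublist.count_le .y
        simp at this; omega
    rcases lt_or_eq_of_le (show ((s.count .y : ℤ) + 1) * q ≤ (s.count .x : ℤ) * p by linarith)
      with hlt' | heq
    · exact hno ⟨_, _, hlt', ⟨_, lt_add_one _, hvis⟩, hnvis⟩
    · have heq' : (s.count .y + 1) * q = s.count .x * p := by exact_mod_cast heq
      have hdvd : q ∣ s.count .x := hpq.symm.dvd_of_dvd_mul_right ⟨s.count .y + 1, by
        rw [← heq', mul_comm]⟩
      have h0 := Nat.eq_zero_of_dvd_of_lt hdvd hlt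
      rw [h0, zero_mul] at heq'
      have : 0 < (s.count .y + 1) * q := Nat.mul_pos (by omega) (by omega)
      omega
  · simp only [reduceCtorEq, false_iff, not_lt]
    have := hbelow (s.count .x) (s.count .y + 1)
      (visits_wordPath.2 ⟨s ++ [.y], ⟨r, by simp [hw]⟩, by simp, by simp⟩)
    linarith

theorem IsNontrivialChristoffelWord.generated {w : List Letter}
    (h : IsNontrivialChristoffelWord w) : Generated w := by
  obtain ⟨⟨p, q, hpq, hc⟩, hx, hy⟩ := h
  obtain ⟨cx, cy⟩ := hc.count
  have hlen := length_eq_count w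
  have hp : 0 < p := by
    refine Nat.pos_of_ne_zero fun hp => hx ?_
    subst hp
    obtain rfl : q = 1 := by simpa using hpq
    obtain ⟨l, rfl⟩ := List.length_eq_one_iff.1 (by omega : w.length = 1)
    cases l <;> simp_all
  have hq : 0 < q := by
    refine Nat.pos_of_ne_zero fun hq => hy ?_
    subst hq
    obtain rfl : p = 1 := by simpa using hpq
    obtain ⟨l, rfl⟩ := List.length_eq_one_iff.1 (by omega : w.length = 1)
    cases l <;> simp_all
  obtain ⟨w', hw', hg, cx', cy'⟩ := exists_generated_greedy _ p q le_rfl hp hq hpq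
  rwa [(hc.greedy hpq).eq hg (by rw [hlen, length_eq_count w']; omega)]

/-! ### The two foldings and their root pairs. -/

/-- The folding data computing `Δ_w`: only `y` is odd, only `x` contributes. -/
noncomputable def deltaData : FoldData ℤ[T;T⁻¹] where
  J := (invert : ℤ[T;T⁻¹] ≃ₐ[ℤ] ℤ[T;T⁻¹])
  J_smul k m := by simp
  J_J m := involutive_invert m
  odd
    | .x => false
    | .y => true
  disp
    | .x => 1
    | .y => 0
  val
    | .x => T 1
    | .y => 0

/-- The folding data computing `Δ` and `t * G` of the image of a word under `x ↦ xy`, `y ↦ y`: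
both letters are odd. -/
noncomputable def pairData : FoldData (ℤ[T;T⁻¹] × ℤ[T;T⁻¹]) where
  -- The factor T 1 encodes the shift s: in tG a dot at i contributes t^(i+1) at even height but t^i
  -- at odd height.
  J :=
    { toFun := fun f => (invert f.1, T 1 * invert f.2)
      map_zero' := by simp
      map_add' := fun f g => by simp [mul_add] }
  J_smul k m := by
    ext1 <;> simp [add_comm]
  J_J m := by
    have (f : ℤ[T;T⁻¹]) : invert (invert f) = f := involutive_invert f
    ext1 <;> simp [this]
  odd _ := true
  disp
    | .x => 1
    | .y => 0
  val
    | .x => (T 1, 0)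
    | .y => (0, T 1)

theorem deltaData_J (f : ℤ[T;T⁻¹]) : deltaData.J f = invert f := rfl

theorem pairData_J (f : ℤ[T;T⁻¹] × ℤ[T;T⁻¹]) :
    pairData.J f = (invert f.1, T 1 * invert f.2) := rfl

theorem deltaData_wval_x (w : List Letter) :
    deltaData.wval (.x :: w) = T 1 + T 1 * deltaData.wval w := rfl

theorem deltaData_wval_y (w : List Letter) :
    deltaData.wval (.y :: w) = invert (deltaData.wval w) := by
  change 0 + T 0 * _ = _
  rw [zero_add, T_zero, one_mul]; rfl

theorem pairData_wval_x (w : List Letter) : pairData.wval (.x :: w) =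
    (T 1 + T 1 * invert (pairData.wval w).1, T 2 * invert (pairData.wval w).2) := by
  change (T 1 + T 1 * invert (pairData.wval w).1, 0 + T 1 * (T 1 * invert (pairData.wval w).2)) = _
  rw [zero_add, ← mul_assoc, ← T_add]; rfl

theorem pairData_wval_y (w : List Letter) : pairData.wval (.y :: w) =
    (invert (pairData.wval w).1, T 1 + T 1 * invert (pairData.wval w).2) := by
  change (0 + T 0 * invert (pairData.wval w).1, T 1 + T 0 * (T 1 * invert (pairData.wval w).2)) = _
  rw [T_zero, zero_add, one_mul, one_mul]

theorem evenOdd_deltaData :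
    deltaData.EvenOdd (fun f => IsLogConcave fun k => f.coeff k) [.x] [.y] := by
  have hx : deltaData.wval [.x] = T 1 := by simp [FoldData.wval, deltaData]
  have hy : deltaData.wval [.y] = 0 := by simp [FoldData.wval, deltaData]
  have dy : deltaData.wdisp [.y] = 0 := by simp [FoldData.wdisp, deltaData]
  refine ⟨rfl, rfl, ?_, ?_, ?_, fun c hc k => ?_⟩
  · simp [FoldData.wdisp, deltaData]
  · simp [hy]
  · rw [hx, hy, dy, deltaData_J, invert_T, smul_eq_mul, ← T_add, smul_zero]; rfl
  · have := (hc.segSum (lo := fun i => i + 2) (hi := fun i => i + 2 * k + 2)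
      (fun i j hij => by dsimp only; omega) (fun i j hij => by dsimp only; omega)
      (fun i => by ring) (fun i => by ring)).isLogConcave 0
    rw [hx, hy, smul_zero, add_zero, smul_eq_mul, mul_comm, hc.shift_segSum]
    simpa using this

/-- The root combination is (c 2, c 3), a pair of consecutive chain terms. -/
theorem oddOdd_pairData :
    pairData.OddOdd (fun f => IsLogConcave (fun k => f.1.coeff k) ∧
      RatioDominated (fun k => f.1.coeff k) fun k => f.2.coeff k) [.x] [.y] := by
  have hx : pairData.wval [.x] = (T 1, 0) := by simp [FoldData.wval, pairData]
  have hy : pairData.wval [.y] = (0, T 1) := by simp [FoldData.wval, pairData]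
  have dx : pairData.wdisp [.x] = 1 := by simp [FoldData.wdisp, pairData]
  have dy : pairData.wdisp [.y] = 0 := by simp [FoldData.wdisp, pairData]
  refine ⟨rfl, rfl, by rw [dx, dy]; rfl, ?_, ?_, fun c hc => ?_⟩
  · rw [hx, dx, pairData_J, invert_T, map_zero, mul_zero, Prod.smul_mk, smul_zero, smul_eq_mul,
      ← T_add]
    rfl
  · rw [hy, dy, pairData_J, invert_T, map_zero, Prod.smul_mk, smul_zero, smul_eq_mul, ← T_add,
      ← T_add]
    rfl
  · have h : c 0 • pairData.wval [.x] + c 1 • pairData.wval [.y] = (c 2, c (2 + 1)) := by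
      have h2 := hc.shift 0
      have h3 := hc.shift 1
      norm_num at h2 h3
      rw [hx, hy, show (2 : ℤ) + 1 = 3 by norm_num, h2, h3]
      ext1 <;> simp
    rw [h]
    exact ⟨hc.isLogConcave 2, hc.ratioDominated 2⟩

/-! ### Reading Δ and G off the folded path. -/

theorem dotPolynomial_cons (d : ℤ × ℤ) (l : List (ℤ × ℤ)) :
    dotPolynomial (d :: l) = T d.1 + dotPolynomial l := by
  simp [dotPolynomial]

theorem xDotsAux_posY (a b : ℤ) (l : List Step) :
    xDotsAux (a, b) (.posY :: l) = xDotsAux (a, b + 1) l := by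
  simp [xDotsAux, Step.vec]

theorem xDotsAux_posX (a b : ℤ) (l : List Step) :
    xDotsAux (a, b) (.posX :: l) = (a + 1, b) :: xDotsAux (a + 1, b) l := by
  simp [xDotsAux, Step.vec]

theorem xDotsAux_negX (a b : ℤ) (l : List Step) :
    xDotsAux (a, b) (.negX :: l) = (a - 1, b) :: xDotsAux (a - 1, b) l := by
  simp [xDotsAux, Step.vec, sub_eq_add_neg]

theorem yyDotsAux_posX (a b : ℤ) (l : List Step) :
    yyDotsAux (a, b) (.posX :: l) = yyDotsAux (a + 1, b) l := by
  simp [yyDotsAux, Step.vec]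

theorem yyDotsAux_negX (a b : ℤ) (l : List Step) :
    yyDotsAux (a, b) (.negX :: l) = yyDotsAux (a - 1, b) l := by
  simp [yyDotsAux, Step.vec, sub_eq_add_neg]

theorem yyDotsAux_posY_posX (a b : ℤ) (l : List Step) :
    yyDotsAux (a, b) (.posY :: .posX :: l) = yyDotsAux (a + 1, b + 1) l := by
  simp [yyDotsAux, Step.vec]

theorem yyDotsAux_posY_negX (a b : ℤ) (l : List Step) :
    yyDotsAux (a, b) (.posY :: .negX :: l) = yyDotsAux (a - 1, b + 1) l := by
  simp [yyDotsAux, Step.vec, sub_eq_add_neg]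

theorem yyDotsAux_posY_posY (a b : ℤ) (l : List Step) :
    yyDotsAux (a, b) (.posY :: .posY :: l) =
      shiftPoint (a, b + 1) :: yyDotsAux (a, b + 1) (.posY :: l) := by
  simp [yyDotsAux, Step.vec]

theorem odd_add_one_iff (h : ℤ) : Odd (h + 1) ↔ ¬ Odd h := by
  rw [Int.odd_iff, Int.odd_iff]; omega

theorem dotPolynomial_xDotsAux (w : List Letter) (a h : ℤ) :
    dotPolynomial (xDotsAux (a, h) (foldSteps h w)) =
      T a * if Odd h then invert (deltaData.wval w) else deltaData.wval w := by
  have hinv (f : ℤ[T;T⁻¹]) : invert (invert f) = f := involutive_invert f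
  induction w generalizing a h with
  | nil => simp [foldSteps, xDotsAux, dotPolynomial, FoldData.wval]
  | cons l w ih =>
    cases l
    · by_cases hh : Odd h
      · simp only [foldSteps, hh, if_true, xDotsAux_negX, dotPolynomial_cons, ih, deltaData_wval_x,
          map_add, map_mul, invert_T, mul_add, ← mul_assoc, ← T_add, sub_eq_add_neg]
      · simp only [foldSteps, hh, if_false, xDotsAux_posX, dotPolynomial_cons, ih, deltaData_wval_x,
          mul_add, ← mul_assoc, ← T_add]
    · by_cases hh : Odd h
      · have hh' : ¬ Odd (h + 1) := by rw [odd_add_one_iff, not_not]; exact hh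
        simp only [foldSteps, xDotsAux_posY, ih, hh, hh', if_true, if_false, deltaData_wval_y, hinv]
      · have hh' : Odd (h + 1) := by rw [odd_add_one_iff]; exact hh
        simp only [foldSteps, xDotsAux_posY, ih, hh, hh', if_true, if_false, deltaData_wval_y]

theorem wordDelta_eq (w : List Letter) : wordDelta w = deltaData.wval w := by
  change dotPolynomial (xDotsAux (0, 0) (foldSteps 0 w)) = _
  simp [dotPolynomial_xDotsAux]

theorem deltaData_wval_substD (w : List Letter) :
    deltaData.wval (substD w) = (pairData.wval w).1 := by
  induction w with
  | nil => rfl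
  | cons l w ih =>
    cases l <;>
      simp only [substD, deltaData_wval_x, deltaData_wval_y, pairData_wval_x, pairData_wval_y, ih]

/-- The leading y-step is the last step of the preceding letter's image, so each yy-center is
charged to the letter y that follows it. -/
theorem dotPolynomial_yyDotsAux (w : List Letter) (a h : ℤ) :
    T 1 * dotPolynomial (yyDotsAux (a, h) (.posY :: foldSteps (h + 1) (substD w))) =
      T a * if Odd (h + 1) then T 1 * invert (pairData.wval w).2 else (pairData.wval w).2 := by
  have hinv (f : ℤ[T;T⁻¹]) : invert (invert f) = f := involutive_invert f
  induction w generalizing a h with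
  | nil => simp [foldSteps, substD, yyDotsAux, dotPolynomial, FoldData.wval]
  | cons l w ih =>
    have hodd : Odd (h + 1 + 1) ↔ ¬ Odd (h + 1) := odd_add_one_iff _
    cases l
    · by_cases hh : Odd (h + 1)
      · simp only [foldSteps, substD, hodd, hh, if_true, if_false, not_true, yyDotsAux_posY_negX, ih,
          pairData_wval_x, map_mul, invert_T, hinv, ← mul_assoc, ← T_add]
        congr 2
      · simp only [foldSteps, substD, hodd, hh, if_true, if_false, not_false_eq_true,
          yyDotsAux_posY_posX, ih, pairData_wval_x, ← mul_assoc, ← T_add]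
        congr 2; ring
    · by_cases hh : Odd (h + 1)
      · simp only [foldSteps, substD, hodd, hh, if_true, if_false, not_true, yyDotsAux_posY_posY, ih,
          dotPolynomial_cons, shiftPoint, mul_add,
          pairData_wval_y, map_add, map_mul, invert_T, hinv, ← mul_assoc, ← T_add]
        congr 2 <;> ring_nf
      · simp only [foldSteps, substD, hodd, hh, if_true, if_false, not_false_eq_true,
          yyDotsAux_posY_posY, dotPolynomial_cons, shiftPoint, mul_add, ih, pairData_wval_y,
          ← mul_assoc, ← T_add]
        congr 2; ring

/-- The initial x matters: an initial y would be charged with a yy-center although no y precedes it.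
-/
theorem T_mul_wordG_substD (w : List Letter) :
    T 1 * wordG (substD (.x :: w)) = (pairData.wval (.x :: w)).2 := by
  change T 1 * dotPolynomial
    (yyDotsAux (0, 0) (foldSteps 0 (.x :: .y :: substD w))) = _
  have h := dotPolynomial_yyDotsAux w 1 0
  have h1 : Odd ((0 : ℤ) + 1) := by decide
  rw [if_pos h1, ← mul_assoc, ← T_add] at h
  simp only [foldSteps, show ¬ Odd (0 : ℤ) by decide, if_false, yyDotsAux_posX, zero_add]
  rw [zero_add] at h
  rw [h, pairData_wval_x]
  rfl

/-- Every y of the image is preceded by x; the clause with a pending y-step keeps the induction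
going. -/
theorem yyDotsAux_substG (w : List Letter) (a b h : ℤ) :
    yyDotsAux (a, b) (foldSteps h (substG w)) = [] ∧
      yyDotsAux (a, b) (.posY :: foldSteps h (substG w)) = [] := by
  induction w generalizing a b h with
  | nil => simp [substG, foldSteps, yyDotsAux]
  | cons l w ih =>
    cases l <;> simp only [substG, foldSteps] <;> split_ifs <;>
      simp only [yyDotsAux_posX, yyDotsAux_negX, yyDotsAux_posY_posX, yyDotsAux_posY_negX, ih,
        and_self]

theorem wordG_substG (w : List Letter) : wordG (substG w) = 0 := by
  change dotPolynomial (yyDotsAux (0, 0) (foldSteps 0 (substG w))) = 0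
  rw [(yyDotsAux_substG w 0 0 0).1]; rfl

/-! ### Conclusion. -/

theorem isLogConcave_wordDelta {w : List Letter} (h : Generated w) :
    IsLogConcave fun k => (wordDelta w).coeff k := by
  obtain ⟨u, v, huv, rfl⟩ := h.exists_treePair
  rw [wordDelta_eq]
  exact FoldData.good_of_treePair (.inr (.inl evenOdd_deltaData)) huv

theorem IsLogConcave.ratioDominated_zero {a : ℤ → ℤ} (h : IsLogConcave a) :
    RatioDominated a fun _ => 0 := by
  refine ⟨⟨h, ?_, ?_, ?_⟩, ?_⟩ <;> simp [IsLogConcave]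

theorem ratioDominated_substG {w : List Letter} (h : Generated (substG w)) :
    RatioDominated (fun k => (wordDelta (substG w)).coeff k)
      fun k => (T 1 * wordG (substG w)).coeff k := by
  simpa [wordG_substG] using (isLogConcave_wordDelta h).ratioDominated_zero

theorem ratioDominated_substD {w : List Letter} (h : Generated w) :
    RatioDominated (fun k => (wordDelta (substD w)).coeff k)
      fun k => (T 1 * wordG (substD w)).coeff k := by
  obtain ⟨u, v, huv, hw⟩ := h.exists_treePair
  have key := (FoldData.good_of_treePair (.inl oddOdd_pairData) huv).2
  rw [← hw, ← deltaData_wval_substD, ← wordDelta_eq] at key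
  obtain ⟨w', rfl⟩ := h.exists_eq_cons
  rwa [T_mul_wordG_substD]

end ChristoffelDelta

theorem theorem4p12 (w : List ChristoffelDelta.Letter)
    (hw : ChristoffelDelta.IsNontrivialChristoffelWord w) :
    ChristoffelDelta.IsLogConcave (fun k : ℤ => (ChristoffelDelta.wordDelta w).coeff k) ∧
    ChristoffelDelta.RatioDominated
      (fun k : ℤ => (ChristoffelDelta.wordDelta w).coeff k)
      (fun k : ℤ => (LaurentPolynomial.T 1 * ChristoffelDelta.wordG w).coeff k) := by
  have h := hw.generated
  refine ⟨ChristoffelDelta.isLogConcave_wordDelta h, ?_⟩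
  cases h with
  -- The word xy is itself the image of y under x ↦ x, y ↦ xy.
  | base => exact ChristoffelDelta.ratioDominated_substG (w := [.y]) .base
  | substG h => exact ChristoffelDelta.ratioDominated_substG (.substG h)
  | substD h => exact ChristoffelDelta.ratioDominated_substD h
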